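/- Let $X$ be a completely regular Hausdorff (Tychonoff) space. Write $C(X)$ for the ring of real-valued continuous functions on $X$, $C^*(X)$ for the subring of bounded functions, $Z(f)=\{x\in X: f(x)=0\}$, and $f^*:\beta X\to\mathbb{R}\cup\{\infty\}$ for the continuous extension of $f\in C(X)$ to the Stone–Čech compactification $\beta X$, with values in the one-point compactification of $\mathbb{R}$. An ideal of closed sets in $X$ is a nonempty family $\mathcal{P}$ of closed subsets of $X$ that is closed under finite unions and under passing to closed subsets. For such $\mathcal{P}$ put $C_{\mathcal{P}}(X)=\{f\in C(X): \mathrm{cl}_X(X\setminus Z(f))\in\mathcal{P}\}$, and for $A\subseteq C(X)$ put $\upsilon_A X=\{p\in\beta X: f^*(p)\in\mathbb{R}\text{ for all } f\in A\}$. Let $\upsilon X=\upsilon_{C(X)}X$ be the Hewitt realcompactification. (1) Every realcompact space $Y$ with $X\subseteq Y\subseteq\beta X$ is of the form $Y=\upsilon_{C_{\mathcal{P}}(X)}X$ for some ideal $\mathcal{P}$ of closed sets in $X$ if and only if $X$ is pseudocompact (that is, $C(X)=C^*(X)$). (2) If $X$ is not pseudocompact, then there is a countably infinite set $T\subseteq\beta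 X\setminus\upsilon X$ such that $C_T=\{f\in C(X): f^*(p)\in\mathbb{R}\text{ for all }p\in T\}$ is a ring with $C^*(X)\subseteq C_T\subseteq C(X)$, $C_T$ is isomorphic to $C(Z)$ for some Tychonoff space $Z$, and $C_T\neq C^*(X)+I=\{g+h: g\in C^*(X),\ h\in I\}$ for every ideal $I$ of $C(X)$. -/

import Mathlib

open Set Filter Topology TopologicalSpace

universe u

namespace ClosedSupport

/-- `X` is pseudocompact: every real-valued continuous function on `X` is bounded. -/
def IsPseudocompact (X : Type u) [TopologicalSpace X] : Prop :=
  ∀ f : C(X, ℝ), ∃ M : ℝ, ∀ x, |f x| ≤ M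

/-- A Tychonoff space `Y` is realcompact (Hewitt; Gillman and Jerison): every real maximal ideal
`M` of `C(Y)` is fixed. Here `M` is real when the canonical copy of `ℝ` is all of `C(Y)/M`, and
fixed when all members of `M` vanish at a common point. Equivalently, every free maximal ideal
is hyper-real. -/
def IsRealcompact (Y : Type u) [TopologicalSpace Y] [T35Space Y] : Prop :=
  ∀ M : Ideal C(Y, ℝ), M.IsMaximal →
    Function.Surjective (algebraMap ℝ (C(Y, ℝ) ⧸ M)) →
    ∃ y : Y, ∀ f ∈ M, f y = 0

section

variable {X : Type u} [TopologicalSpace X]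

/-- The Stone extension `f* : βX → ℝ ∪ {∞}` of `f ∈ C(X)`, with values in the one-point
compactification of `ℝ`. -/
noncomputable def stoneExt (f : C(X, ℝ)) : StoneCech X → OnePoint ℝ :=
  stoneCechExtend (g := fun x => (f x : OnePoint ℝ)) (OnePoint.continuous_coe.comp f.continuous)

/-- `f*` is real at `p`, that is, `f*(p) ∈ ℝ`. -/
def IsRealAt (f : C(X, ℝ)) (p : StoneCech X) : Prop :=
  ∃ r : ℝ, stoneExt f p = (r : OnePoint ℝ)

/-- `υ_A X`: the points of `βX` at which the Stone extension of every `f ∈ A` is real. -/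
def upsilon (A : Set C(X, ℝ)) : Set (StoneCech X) :=
  {p | ∀ f ∈ A, IsRealAt f p}

/-- The Hewitt realcompactification `υX = υ_{C(X)} X`, as a subset of `βX`. -/
def hewitt (X : Type u) [TopologicalSpace X] : Set (StoneCech X) :=
  upsilon (univ : Set C(X, ℝ))

/-- `C_P(X)`: the functions in `C(X)` whose support `cl_X (X \ Z(f))` belongs to `P`.
An ideal of closed sets in `X` is an order ideal of the lattice `Closeds X`, that is, a nonempty
family of closed sets that is closed under binary unions and under passing to closed subsets. -/
def supportIn (P : Order.Ideal (Closeds X)) : Set C(X, ℝ) :=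
  {f | Closeds.closure {x | f x = 0}ᶜ ∈ P}

/-- `C*(X)`: the bounded functions in `C(X)`. -/
def boundedFns (X : Type u) [TopologicalSpace X] : Set C(X, ℝ) :=
  {f | ∃ M : ℝ, ∀ x, |f x| ≤ M}

/-- `C*(X) + I`. -/
def boundedAdd (I : Ideal C(X, ℝ)) : Set C(X, ℝ) :=
  {h | ∃ f ∈ boundedFns X, ∃ g ∈ I, h = f + g}

lemma stoneExt_tendsto (f : C(X, ℝ)) (p : StoneCech X) :
    Tendsto (fun x => (f x : OnePoint ℝ)) (comap stoneCechUnit (𝓝 p)) (𝓝 (stoneExt f p)) := by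
  have h : Continuous (stoneExt f) := continuous_stoneCechExtend _
  have h2 : (fun x => (f x : OnePoint ℝ)) = stoneExt f ∘ stoneCechUnit :=
    (stoneCechExtend_extends _).symm
  rw [h2]
  exact (h.tendsto p).comp tendsto_comap

/-- `f*` is real at `p` exactly when `f` has a real limit along the trace on `X` of the
neighbourhood filter of `p`. -/
lemma isRealAt_iff (f : C(X, ℝ)) (p : StoneCech X) :
    IsRealAt f p ↔ ∃ r : ℝ, Tendsto f (comap stoneCechUnit (𝓝 p)) (𝓝 r) := by
  have hne : (comap (stoneCechUnit : X → StoneCech X) (𝓝 p)).NeBot := by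
    rw [comap_neBot_iff]
    intro t ht
    obtain ⟨_, h1, x, rfl⟩ := mem_closure_iff_nhds.1 (denseRange_stoneCechUnit p) t ht
    exact ⟨x, h1⟩
  refine exists_congr fun r => ?_
  rw [OnePoint.isOpenEmbedding_coe.tendsto_nhds_iff]
  constructor
  · intro h
    rw [← h]
    exact stoneExt_tendsto f p
  · intro h
    exact tendsto_nhds_unique (stoneExt_tendsto f p) h

/-- `C_T`, for `T ⊆ βX`: the ring of those `f ∈ C(X)` whose Stone extension is real at every
point of `T`. -/
def realOn (T : Set (StoneCech X)) : Subring C(X, ℝ) where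
  carrier := {f | ∀ p ∈ T, IsRealAt f p}
  mul_mem' := by
    intro f g hf hg p hp
    obtain ⟨r, hr⟩ := (isRealAt_iff f p).1 (hf p hp)
    obtain ⟨s, hs⟩ := (isRealAt_iff g p).1 (hg p hp)
    exact (isRealAt_iff _ p).2 ⟨r * s, hr.mul hs⟩
  one_mem' := fun p _ => (isRealAt_iff _ p).2 ⟨1, tendsto_const_nhds⟩
  add_mem' := by
    intro f g hf hg p hp
    obtain ⟨r, hr⟩ := (isRealAt_iff f p).1 (hf p hp)
    obtain ⟨s, hs⟩ := (isRealAt_iff g p).1 (hg p hp)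
    exact (isRealAt_iff _ p).2 ⟨r + s, hr.add hs⟩
  zero_mem' := fun p _ => (isRealAt_iff _ p).2 ⟨0, tendsto_const_nhds⟩
  neg_mem' := by
    intro f hf p hp
    obtain ⟨r, hr⟩ := (isRealAt_iff f p).1 (hf p hp)
    exact (isRealAt_iff _ p).2 ⟨-r, hr.neg⟩

/-- An intermediate ring: a ring between `C*(X)` and `C(X)`. -/
def IsIntermediate (A : Subring C(X, ℝ)) : Prop :=
  boundedFns X ⊆ (A : Set C(X, ℝ))

/-- A ring is of `C`-type if it is isomorphic to `C(Z)` for some Tychonoff space `Z`. -/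
def IsCType (A : Type u) [Ring A] : Prop :=
  ∃ (Z : Type u) (_ : TopologicalSpace Z) (_ : T35Space Z), Nonempty (A ≃+* C(Z, ℝ))

end

end ClosedSupport

/-!
The argument rests on one observation about poles of Stone extensions. If `I ⊆ C(X)` is closed
under multiplication by `C(X)`, then the set of points of `βX` at which some member of `I` is
infinite is *relatively open* in `βX \ υX` (`exists_mem_not_isRealAt`): if `f ∈ I` is infinite at
`q`, then `|f| ≥ 1` near `q`, so at a nearby point `p ∉ υX`, where some `g ∈ C(X)` is infinite,
the product `g * f ∈ I` is infinite as well. Both `C_P(X)` and any ideal of `C(X)` are such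
families.

If `f ∈ C(X)` is unbounded, the closed set `{f* = ∞}` is infinite (`infinite_not_isRealAt`), hence
contains a countably infinite set `T` together with a cluster point `q ∉ T`
(`exists_countable_poles`). Put `Y = υX ∪ T`. Since `T` is countable, every point outside `Y` is a
zero of a continuous function on `βX` that is positive on `Y` (`exists_zero_pos_on_union`). This
makes `Y` realcompact (`isRealcompact_of_exists_zero`) and provides a function in `C_T` that is
infinite at `q`. Restriction to `X` identifies `C(Y)` with `C_T` (`isCType_realOn`). As the points
of `T` accumulate at `q` while `T ⊆ Y` and `q ∉ Y`, the observation above excludes both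
`Y = υ_{C_P(X)} X` and `C_T = C*(X) + I`.

Conversely, if `X` is pseudocompact, then for `p ∈ βX` and `X ⊆ Y ⊆ βX` the limit at `p` is a real
character of `C(Y)`. When `Y` is realcompact it is the evaluation at a point of `Y`, which can only
be `p`; so `Y = βX` (`eq_univ_of_isRealcompact`).
-/

namespace ClosedSupport

section

variable {X : Type u} [TopologicalSpace X]

/-! ### Real and infinite values of Stone extensions -/

instance comap_stoneCechUnit_nhds_neBot (p : StoneCech X) :
    (comap (stoneCechUnit : X → StoneCech X) (𝓝 p)).NeBot := by
  rw [comap_neBot_iff]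
  intro t ht
  obtain ⟨_, h1, x, rfl⟩ := mem_closure_iff_nhds.1 (denseRange_stoneCechUnit p) t ht
  exact ⟨x, h1⟩

lemma continuous_stoneExt (f : C(X, ℝ)) : Continuous (stoneExt f) :=
  continuous_stoneCechExtend _

lemma stoneExt_stoneCechUnit (f : C(X, ℝ)) (x : X) :
    stoneExt f (stoneCechUnit x) = (f x : OnePoint ℝ) :=
  congrFun (stoneCechExtend_extends (g := fun x => (f x : OnePoint ℝ))
    (OnePoint.continuous_coe.comp f.continuous)) x

lemma not_isRealAt_iff_eq_infty (f : C(X, ℝ)) (p : StoneCech X) :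
    ¬ IsRealAt f p ↔ stoneExt f p = OnePoint.infty := by
  rw [← not_iff_not, not_not, ← ne_eq, OnePoint.ne_infty_iff_exists]
  exact exists_congr fun r => eq_comm

lemma not_isRealAt_iff_tendsto (f : C(X, ℝ)) (p : StoneCech X) :
    ¬ IsRealAt f p ↔ Tendsto (fun x => |f x|) (comap stoneCechUnit (𝓝 p)) atTop := by
  constructor
  · intro h
    have h1 := stoneExt_tendsto f p
    rw [(not_isRealAt_iff_eq_infty f p).1 h] at h1
    have h2 : Tendsto f (comap stoneCechUnit (𝓝 p))
        (comap ((↑) : ℝ → OnePoint ℝ) (𝓝 OnePoint.infty)) := tendsto_comap_iff.2 h1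
    rw [OnePoint.comap_coe_nhds_infty, coclosedCompact_eq_cocompact] at h2
    exact (tendsto_norm_cocompact_atTop (E := ℝ)).comp h2
  · intro h hr
    obtain ⟨r, hr⟩ := (isRealAt_iff f p).1 hr
    exact not_tendsto_nhds_of_tendsto_atTop h _ hr.abs

lemma isRealAt_of_bounded {f : C(X, ℝ)} (hf : f ∈ boundedFns X) (p : StoneCech X) :
    IsRealAt f p := by
  obtain ⟨M, hM⟩ := hf
  by_contra h
  obtain ⟨x, hx⟩ := (((not_isRealAt_iff_tendsto f p).1 h).eventually_gt_atTop M).exists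
  exact absurd (hM x) (not_le.2 hx)

/-- A function whose Stone extension is real on `A ⊆ βX` extends continuously to `A`, with real
values. -/
lemma exists_extension {f : C(X, ℝ)} {A : Set (StoneCech X)} (hf : ∀ p ∈ A, IsRealAt f p) :
    ∃ F : C(A, ℝ), ∀ p : A, (F p : OnePoint ℝ) = stoneExt f p := by
  choose F hF using fun p : A => hf p p.2
  refine ⟨⟨F, ?_⟩, fun p => (hF p).symm⟩
  rw [OnePoint.isOpenEmbedding_coe.continuous_iff]
  exact ((continuous_stoneExt f).comp continuous_subtype_val).congr hF

lemma exists_extension_of_bounded {f : C(X, ℝ)} (hf : f ∈ boundedFns X) :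
    ∃ F : C(StoneCech X, ℝ), ∀ x, F (stoneCechUnit x) = f x := by
  obtain ⟨F, hF⟩ := exists_extension (A := univ) fun p _ => isRealAt_of_bounded hf p
  refine ⟨F.comp ⟨fun p => ⟨p, mem_univ p⟩, by fun_prop⟩, fun x => ?_⟩
  exact OnePoint.coe_injective ((hF ⟨stoneCechUnit x, mem_univ _⟩).trans
    (stoneExt_stoneCechUnit f x))

/-- If `I` absorbs multiplication by `C(X)`, then the poles of members of `I` form a relatively
open subset of `βX \ υX`; in particular a pole `q` in the closure of `T ⊆ βX \ υX` forces a pole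
in `T`. -/
lemma exists_mem_not_isRealAt {I : Set C(X, ℝ)} (hI : ∀ g, ∀ f ∈ I, g * f ∈ I)
    {T : Set (StoneCech X)} (hT : T ⊆ (hewitt X)ᶜ) {q : StoneCech X} (hq : q ∈ closure T)
    {f : C(X, ℝ)} (hf : f ∈ I) (hfq : ¬ IsRealAt f q) :
    ∃ p ∈ T, ∃ h ∈ I, ¬ IsRealAt h p := by
  have h1 := ((not_isRealAt_iff_tendsto f q).1 hfq).eventually_ge_atTop 1
  rw [eventually_comap, ← eventually_eventually_nhds] at h1
  obtain ⟨p, hp, hpT⟩ := mem_closure_iff_nhds.1 hq _ h1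
  have hp' : ∀ᶠ x in comap stoneCechUnit (𝓝 p), 1 ≤ |f x| := eventually_comap.2 hp
  have hpυ := hT hpT
  simp only [hewitt, upsilon, mem_compl_iff, mem_ofPred_eq, not_forall] at hpυ
  obtain ⟨g, -, hg⟩ := hpυ
  refine ⟨p, hpT, g * f, hI g f hf, ?_⟩
  rw [not_isRealAt_iff_tendsto] at hg ⊢
  refine tendsto_atTop_mono' _ ?_ hg
  filter_upwards [hp'] with x hx
  rw [ContinuousMap.mul_apply, abs_mul]
  exact le_mul_of_one_le_right (abs_nonneg _) hx

lemma range_subset_hewitt : range (stoneCechUnit : X → StoneCech X) ⊆ hewitt X := by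
  rintro _ ⟨x, rfl⟩ f -
  exact ⟨f x, stoneExt_stoneCechUnit f x⟩

lemma mul_mem_supportIn (P : Order.Ideal (Closeds X)) (g : C(X, ℝ)) {f : C(X, ℝ)}
    (hf : f ∈ supportIn P) : g * f ∈ supportIn P := by
  refine P.lower (Closeds.gc.monotone_l ?_) hf
  intro x hx h0
  refine hx ?_
  have h0 : f x = 0 := h0
  simp [h0]

/-! ### A countable set of poles that is not relatively closed -/

/-- The poles of an unbounded function form an infinite set. -/
lemma infinite_not_isRealAt {f : C(X, ℝ)} (hf : ∀ M : ℝ, ∃ x, M < |f x|) :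
    {p : StoneCech X | ¬ IsRealAt f p}.Infinite := by
  -- A sequence along which `|f|` increases by at least `1` at each step.
  choose s hs using hf
  let x : ℕ → X := fun n => Nat.rec (s 0) (fun _ y => s (|f y| + 1)) n
  let a : ℕ → ℝ := fun n => |f (x n)|
  have ha : ∀ n, a n + 1 ≤ a (n + 1) := fun n => (hs (|f (x n)| + 1)).le
  have hadd : ∀ n k, a n + k ≤ a (n + k) := by
    intro n k
    induction k with
    | zero => simp
    | succ k ih =>
      have := ha (n + k)
      push_cast
      rw [← add_assoc n k 1]
      linarith
  have hge : ∀ n : ℕ, (n : ℝ) ≤ a n := by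
    intro n
    have h1 := hadd 0 n
    have h2 : 0 ≤ a 0 := abs_nonneg _
    rw [zero_add] at h1
    linarith
  have hdist : Pairwise fun m n => 1 ≤ dist (a m) (a n) := by
    have key : ∀ m n, m < n → 1 ≤ dist (a m) (a n) := by
      intro m n hmn
      obtain ⟨k, rfl⟩ := Nat.exists_eq_add_of_lt hmn
      have h1 := hadd m (k + 1)
      push_cast at h1
      rw [← add_assoc m k 1] at h1
      have h2 : (0 : ℝ) ≤ k := k.cast_nonneg
      rw [dist_comm, Real.dist_eq]
      exact le_trans (by linarith) (le_abs_self _)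
    intro m n hmn
    rcases lt_or_gt_of_ne hmn with h | h
    · exact key m n h
    · rw [dist_comm]
      exact key n m h
  have hemb : IsClosedEmbedding a := Metric.isClosedEmbedding_of_pairwise_le_dist one_pos hdist
  -- By Tietze, some `u ∘ |f|` takes every value `k ∈ ℕ` infinitely often along the sequence.
  obtain ⟨u, hu⟩ := ContinuousMap.exists_extension hemb
    (⟨fun n => ((Nat.unpair n).1 : ℝ), by fun_prop⟩ : C(ℕ, ℝ))
  have hu' : ∀ n, u (a n) = ((Nat.unpair n).1 : ℝ) := fun n => DFunLike.congr_fun hu n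
  let g : C(X, ℝ) := u.comp ⟨fun y => |f y|, by fun_prop⟩
  have hpole : ∀ k : ℕ, ∃ p, ¬ IsRealAt f p ∧ stoneExt g p = ((k : ℝ) : OnePoint ℝ) := by
    intro k
    let y : ℕ → X := fun n => x (Nat.pair k n)
    obtain ⟨p, -, hp⟩ := isCompact_univ (X := StoneCech X)
      (f := (hyperfilter ℕ : Filter ℕ).map (stoneCechUnit ∘ y)) (by simp)
    obtain ⟨W, hW, hWp⟩ := (mapClusterPt_iff_ultrafilter
      (u := stoneCechUnit ∘ y) (F := (hyperfilter ℕ : Filter ℕ))).1 hp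
    have hWtop : (W : Filter ℕ) ≤ atTop := hW.trans Nat.hyperfilter_le_atTop
    have hf1 := ((continuous_stoneExt f).tendsto p).comp hWp
    have hg1 := ((continuous_stoneExt g).tendsto p).comp hWp
    refine ⟨p, ?_, ?_⟩
    · rintro ⟨r, hr⟩
      rw [hr] at hf1
      have h2 : Tendsto (fun n => ((f (y n) : ℝ) : OnePoint ℝ)) W (𝓝 (r : OnePoint ℝ)) :=
        hf1.congr fun n => stoneExt_stoneCechUnit f _
      have h3 : Tendsto (fun n => f (y n)) W (𝓝 r) :=
        OnePoint.isOpenEmbedding_coe.tendsto_nhds_iff.2 h2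
      refine not_tendsto_nhds_of_tendsto_atTop ?_ _ h3.abs
      refine tendsto_atTop_mono (fun n => ?_)
        ((tendsto_natCast_atTop_atTop (R := ℝ)).mono_left hWtop)
      exact le_trans (Nat.cast_le.2 (Nat.right_le_pair k n)) (hge _)
    · refine tendsto_nhds_unique hg1 (tendsto_const_nhds.congr fun n => ?_)
      have : g (y n) = k := by
        change u (a (Nat.pair k n)) = k
        rw [hu', Nat.unpair_pair]
      rw [Function.comp_apply, Function.comp_apply, stoneExt_stoneCechUnit, this]
  choose p hp hgp using hpole
  refine Set.infinite_of_injective_forall_mem (f := p) (fun k l hkl => ?_) hp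
  have := hgp k
  rw [hkl, hgp l] at this
  exact_mod_cast (OnePoint.coe_injective this).symm

lemma exists_countable_poles (hX : ¬ IsPseudocompact X) :
    ∃ T : Set (StoneCech X), T.Countable ∧ T.Infinite ∧ T ⊆ (hewitt X)ᶜ ∧
      ∃ q ∈ closure T, q ∉ hewitt X ∪ T := by
  simp only [IsPseudocompact, not_forall, not_exists, not_le] at hX
  obtain ⟨f, hf⟩ := hX
  set E := {p : StoneCech X | ¬ IsRealAt f p}
  have hEc : IsClosed E := by
    have : E = stoneExt f ⁻¹' {OnePoint.infty} := by
      ext p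
      exact not_isRealAt_iff_eq_infty f p
    rw [this]
    exact isClosed_singleton.preimage (continuous_stoneExt f)
  have hEυ : E ⊆ (hewitt X)ᶜ := fun p hp h => hp (h f (mem_univ f))
  obtain ⟨S, hSE, hSc, hSi⟩ : ∃ S ⊆ E, S.Countable ∧ S.Infinite := by
    let e := (infinite_not_isRealAt hf).natEmbedding
    refine ⟨range fun n => (e n : StoneCech X), ?_, countable_range _, ?_⟩
    · rintro _ ⟨n, rfl⟩
      exact (e n).2
    · exact infinite_range_of_injective (Subtype.val_injective.comp e.injective)
  obtain ⟨q, hqE, hq⟩ := hSi.exists_accPt_of_subset_isCompact hEc.isCompact hSE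
  refine ⟨S \ {q}, hSc.mono sdiff_subset, hSi.sdiff (finite_singleton q),
    sdiff_subset.trans (hSE.trans hEυ), q, ?_, ?_⟩
  · rwa [accPt_principal_iff_clusterPt, ← mem_closure_iff_clusterPt] at hq
  · rintro (h | h)
    · exact hEυ hqE h
    · exact h.2 rfl

/-! ### Realcompact subspaces of the Stone–Čech compactification -/

lemma exists_common_zero {K : Type*} [TopologicalSpace K] [CompactSpace K] [T2Space K]
    {J : Ideal C(K, ℝ)} (hJ : J ≠ ⊤) : ∃ q, ∀ f ∈ J, f q = 0 := by
  by_contra! h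
  have h1 : ContinuousMap.setOfIdeal J = univ :=
    eq_univ_of_forall fun q => ContinuousMap.mem_setOfIdeal.2 (h q)
  have h2 := ContinuousMap.idealOfSet_ofIdeal_eq_closure J
  rw [h1] at h2
  refine Ideal.closure_ne_top J hJ (h2.symm.trans ?_)
  rw [Ideal.eq_top_iff_one, ContinuousMap.mem_idealOfSet]
  simp

lemma eqOn_of_eq_stoneCechUnit {Y : Set (StoneCech X)} (hY : range stoneCechUnit ⊆ Y)
    {F G : C(Y, ℝ)} (h : ∀ x, F ⟨stoneCechUnit x, hY ⟨x, rfl⟩⟩ = G ⟨stoneCechUnit x, hY ⟨x, rfl⟩⟩) :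
    F = G := by
  have hd : DenseRange fun x : X => (⟨stoneCechUnit x, hY ⟨x, rfl⟩⟩ : Y) := by
    intro y
    rw [closure_subtype]
    have h1 := denseRange_stoneCechUnit y.1
    rwa [← range_comp]
  exact DFunLike.coe_injective (hd.equalizer F.continuous G.continuous (funext h))

/-- A subspace `Y ⊇ X` of `βX` is realcompact when every point outside it lies in a zero-set of
`βX` that misses `Y`. -/
lemma isRealcompact_of_exists_zero {Y : Set (StoneCech X)} (hY : range stoneCechUnit ⊆ Y)
    (h : ∀ q ∉ Y, ∃ k : C(StoneCech X, ℝ), k q = 0 ∧ ∀ y ∈ Y, 0 < k y) :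
    IsRealcompact Y := by
  intro M hM hsurj
  let res : C(StoneCech X, ℝ) →ₐ[ℝ] C(Y, ℝ) :=
    ContinuousMap.compRightAlgHom ℝ ℝ ⟨Subtype.val, continuous_subtype_val⟩
  have hres : ∀ (k : C(StoneCech X, ℝ)) (y : Y), res k y = k y := fun _ _ => rfl
  have hJ : M.comap res ≠ ⊤ := Ideal.comap_ne_top _ hM.ne_top
  obtain ⟨q, hq⟩ := exists_common_zero hJ
  -- Since `M` is real, `k` is congruent to a constant modulo `M`, and that constant is `k q`.
  have hmem : ∀ k : C(StoneCech X, ℝ), k q = 0 → res k ∈ M := by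
    intro k hk
    obtain ⟨r, hr⟩ := hsurj (Ideal.Quotient.mk M (res k))
    have h1 : algebraMap ℝ C(Y, ℝ) r - res k ∈ M := Ideal.Quotient.eq.1 hr
    have h2 : algebraMap ℝ C(StoneCech X, ℝ) r - k ∈ M.comap res := by
      rw [Ideal.mem_comap, map_sub, AlgHom.commutes]
      exact h1
    have h3 : r - k q = 0 := hq _ h2
    have h4 : r = 0 := by linarith
    rw [h4, map_zero, zero_sub] at h1
    exact (neg_mem_iff (S := Ideal C(Y, ℝ))).1 h1
  have hqY : q ∈ Y := by
    by_contra hqY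
    obtain ⟨k, hk0, hk⟩ := h q hqY
    have hu : IsUnit (res k) :=
      (ContinuousMap.isUnit_iff_forall_ne_zero _).2 fun y => (hk y y.2).ne'
    exact hM.ne_top (Ideal.eq_top_of_isUnit_mem _ (hmem k hk0) hu)
  refine ⟨⟨q, hqY⟩, fun f hf => ?_⟩
  -- `f² / (1 + f²)` lies in `M` and is bounded, hence comes from `C(βX)`.
  let w : C(Y, ℝ) := ⟨fun y => f y / (1 + f y ^ 2),
    f.continuous.div (by fun_prop) fun y => by positivity⟩
  let v : C(X, ℝ) := ⟨fun x => (w * f) ⟨stoneCechUnit x, hY ⟨x, rfl⟩⟩,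
    (w * f).continuous.comp (continuous_stoneCechUnit.subtype_mk _)⟩
  have hv : v ∈ boundedFns X := by
    refine ⟨1, fun x => ?_⟩
    set t := f ⟨stoneCechUnit x, hY ⟨x, rfl⟩⟩
    have : v x = t / (1 + t ^ 2) * t := rfl
    rw [this, abs_le, div_mul_eq_mul_div, le_div_iff₀ (by positivity), div_le_one (by positivity)]
    constructor <;> nlinarith [sq_nonneg t]
  obtain ⟨F, hF⟩ := exists_extension_of_bounded hv
  have hFw : res F = w * f := eqOn_of_eq_stoneCechUnit hY hF
  have h0 : F q = 0 := by
    refine hq F ?_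
    rw [Ideal.mem_comap]
    exact hFw ▸ M.mul_mem_left w hf
  have h1 : w ⟨q, hqY⟩ * f ⟨q, hqY⟩ = 0 := by
    rw [← ContinuousMap.mul_apply, ← hFw, hres, h0]
  have h2 : f ⟨q, hqY⟩ / (1 + f ⟨q, hqY⟩ ^ 2) * f ⟨q, hqY⟩ = 0 := h1
  have h3 : (1 + f ⟨q, hqY⟩ ^ 2) ≠ 0 := by positivity
  simpa [h3] using h2

/-- Every point outside `υX ∪ T`, for a countable `T`, lies in a zero-set of `βX` that misses
`υX ∪ T`. -/
lemma exists_zero_pos_on_union {T : Set (StoneCech X)} (hT : T.Countable) {q : StoneCech X}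
    (hq : q ∉ hewitt X ∪ T) :
    ∃ k : C(StoneCech X, ℝ), k q = 0 ∧ ∀ y ∈ hewitt X ∪ T, 0 < k y := by
  rw [mem_union, not_or] at hq
  obtain ⟨hqυ, hqT⟩ := hq
  simp only [hewitt, upsilon, mem_ofPred_eq, not_forall] at hqυ
  obtain ⟨f, -, hf⟩ := hqυ
  let g : C(X, ℝ) := ⟨fun x => (1 + |f x|)⁻¹,
    Continuous.inv₀ (by fun_prop) fun x => by positivity⟩
  have hg : g ∈ boundedFns X := by
    refine ⟨1, fun x => ?_⟩
    change |(1 + |f x|)⁻¹| ≤ 1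
    rw [abs_of_nonneg (by positivity)]
    exact inv_le_one_of_one_le₀ (by linarith [abs_nonneg (f x)])
  obtain ⟨G, hG⟩ := exists_extension_of_bounded hg
  have hGt : ∀ p, Tendsto g (comap stoneCechUnit (𝓝 p)) (𝓝 (G p)) := fun p =>
    ((G.continuous.tendsto p).comp tendsto_comap).congr hG
  have hGq : G q = 0 := by
    refine tendsto_nhds_unique (hGt q) (tendsto_inv_atTop_zero.comp ?_)
    exact tendsto_atTop_add_const_left _ 1 ((not_isRealAt_iff_tendsto f q).1 hf)
  have hGυ : ∀ y ∈ hewitt X, 0 < G y := by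
    intro y hy
    obtain ⟨r, hr⟩ := (isRealAt_iff f y).1 (hy f (mem_univ f))
    have h1 : 0 < (1 + |r|)⁻¹ := by positivity
    rwa [tendsto_nhds_unique (hGt y) ((tendsto_const_nhds.add hr.abs).inv₀ (by positivity))]
  have hG0 : ∀ y, 0 ≤ G y := fun y => ge_of_tendsto' (hGt y) fun x => by
    change 0 ≤ (1 + |f x|)⁻¹
    positivity
  have hsep : ∀ p : T, ∃ k : C(StoneCech X, ℝ), k q = 0 ∧ k p = 1 ∧ ∀ y, k y ∈ Icc (0 : ℝ) 1 := by
    intro p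
    have hne : q ≠ p := fun h => hqT (h ▸ p.2)
    obtain ⟨k, hk0, hk1, hk⟩ := exists_continuous_zero_one_of_isClosed
      (isClosed_singleton (x := q)) (isClosed_singleton (x := p.1)) (by simpa using hne)
    exact ⟨k, hk0 rfl, hk1 rfl, hk⟩
  choose k hk0 hk1 hk using hsep
  have : Countable T := hT
  obtain ⟨c, hc, C, hcC, -⟩ := NNReal.exists_pos_sum_of_countable one_ne_zero T
  have hcs : Summable fun p => (c p : ℝ) := NNReal.summable_coe.2 hcC.summable
  have hle : ∀ p y, ‖(c p : ℝ) * k p y‖ ≤ c p := by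
    intro p y
    rw [Real.norm_eq_abs, abs_of_nonneg (mul_nonneg (c p).coe_nonneg (hk p y).1)]
    exact mul_le_of_le_one_right (c p).coe_nonneg (hk p y).2
  let S : C(StoneCech X, ℝ) := ⟨fun y => ∑' p, (c p : ℝ) * k p y,
    continuous_tsum (fun p => by fun_prop) hcs hle⟩
  have hS0 : ∀ y, 0 ≤ S y := fun y => tsum_nonneg fun p => mul_nonneg (c p).coe_nonneg (hk p y).1
  refine ⟨G + S, ?_, ?_⟩
  · have : S q = 0 := by
      change ∑' p, (c p : ℝ) * k p q = 0
      simp [hk0]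
    simp [hGq, this]
  · rintro y (hy | hy)
    · exact add_pos_of_pos_of_nonneg (hGυ y hy) (hS0 y)
    · refine add_pos_of_nonneg_of_pos (hG0 y) ?_
      refine (Summable.of_norm_bounded hcs fun p => hle p y).tsum_pos
        (fun p => mul_nonneg (c p).coe_nonneg (hk p y).1) ⟨y, hy⟩ ?_
      rw [hk1 ⟨y, hy⟩, mul_one]
      exact hc _

/-- A realcompact space between a pseudocompact `X` and `βX` is `βX`. -/
lemma eq_univ_of_isRealcompact (hX : IsPseudocompact X) {Y : Set (StoneCech X)}
    (hY : range stoneCechUnit ⊆ Y) (hYr : IsRealcompact Y) : Y = univ := by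
  refine eq_univ_of_forall fun p => ?_
  let ι : X → Y := fun x => ⟨stoneCechUnit x, hY ⟨x, rfl⟩⟩
  have hι : Continuous ι := continuous_stoneCechUnit.subtype_mk _
  have hlim : ∀ f : C(Y, ℝ), ∃ r, Tendsto (f ∘ ι) (comap stoneCechUnit (𝓝 p)) (𝓝 r) := fun f =>
    (isRealAt_iff (f.comp ⟨ι, hι⟩) p).1 (isRealAt_of_bounded (hX _) p)
  choose φ hφ using hlim
  -- The limit at `p`, a ring homomorphism whose kernel is a real maximal ideal.
  let Φ : C(Y, ℝ) →+* ℝ :=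
    { toFun := φ
      map_one' := tendsto_nhds_unique (hφ 1) tendsto_const_nhds
      map_zero' := tendsto_nhds_unique (hφ 0) tendsto_const_nhds
      map_add' := fun f g => tendsto_nhds_unique (hφ (f + g)) ((hφ f).add (hφ g))
      map_mul' := fun f g => tendsto_nhds_unique (hφ (f * g)) ((hφ f).mul (hφ g)) }
  have hΦc : ∀ r : ℝ, Φ (algebraMap ℝ C(Y, ℝ) r) = r := fun r =>
    tendsto_nhds_unique (hφ _) tendsto_const_nhds
  obtain ⟨y, hy⟩ := hYr (RingHom.ker Φ)
    (RingHom.ker_isMaximal_of_surjective Φ fun r => ⟨_, hΦc r⟩) (by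
      intro z
      obtain ⟨f, rfl⟩ := Ideal.Quotient.mk_surjective z
      refine ⟨Φ f, Ideal.Quotient.eq.2 ?_⟩
      rw [RingHom.mem_ker, map_sub]
      exact sub_eq_zero.2 (hΦc _))
  by_contra hp
  have hne : p ≠ y := fun h => hp (h ▸ y.2)
  obtain ⟨k, hk0, hk1, -⟩ := exists_continuous_zero_one_of_isClosed
    (isClosed_singleton (x := p)) (isClosed_singleton (x := y.1)) (by simpa using hne)
  have hkp : k p = 0 := hk0 rfl
  have hky : k y = 1 := hk1 rfl
  have h0 := hy (k.comp ⟨Subtype.val, continuous_subtype_val⟩) (by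
    rw [RingHom.mem_ker]
    refine tendsto_nhds_unique (hφ _) ?_
    rw [← hkp]
    exact (k.continuous.tendsto p).comp tendsto_comap)
  have h1 : k y = 0 := h0
  linarith

/-! ### The ring `C_T` -/

lemma isIntermediate_realOn (T : Set (StoneCech X)) : IsIntermediate (realOn T) :=
  fun _ hf p _ => isRealAt_of_bounded hf p

/-- Restriction to `X` identifies `C(υX ∪ T)` with `C_T`. -/
lemma isCType_realOn (T : Set (StoneCech X)) : IsCType (realOn T) := by
  set Y := hewitt X ∪ T
  have hY : range stoneCechUnit ⊆ Y := range_subset_hewitt.trans subset_union_left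
  let ι : C(X, Y) :=
    ⟨fun x => ⟨stoneCechUnit x, hY ⟨x, rfl⟩⟩, continuous_stoneCechUnit.subtype_mk _⟩
  let res : C(Y, ℝ) →+* C(X, ℝ) := (ContinuousMap.compRightAlgHom ℝ ℝ ι).toRingHom
  have hres : ∀ F x, res F x = F (ι x) := fun _ _ => rfl
  have hmem : ∀ F, res F ∈ realOn T := by
    intro F p hp
    refine (isRealAt_iff _ p).2 ⟨F ⟨p, Or.inr hp⟩, ?_⟩
    refine (F.continuous.tendsto ⟨p, Or.inr hp⟩).comp ?_
    rw [tendsto_subtype_rng]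
    exact tendsto_comap
  refine ⟨Y, inferInstance, inferInstance,
    ⟨(RingEquiv.ofBijective (res.codRestrict (realOn T) hmem) ⟨?_, ?_⟩).symm⟩⟩
  · intro F G h
    exact eqOn_of_eq_stoneCechUnit hY fun x => DFunLike.congr_fun (congrArg Subtype.val h) x
  · rintro ⟨f, hf⟩
    obtain ⟨F, hF⟩ := exists_extension (f := f) (A := Y) (by
      rintro p (hp | hp)
      · exact hp f (mem_univ f)
      · exact hf p hp)
    refine ⟨F, Subtype.ext (ContinuousMap.ext fun x => ?_)⟩
    exact OnePoint.coe_injective ((hF (ι x)).trans (stoneExt_stoneCechUnit f x))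

/-- The reciprocal of a function on `βX` that vanishes at `q` and is positive on `υX ∪ T` is a
member of `C_T` with a pole at `q`. -/
lemma exists_mem_realOn_not_isRealAt {T : Set (StoneCech X)} (hT : T.Countable)
    {q : StoneCech X} (hq : q ∉ hewitt X ∪ T) : ∃ f ∈ realOn T, ¬ IsRealAt f q := by
  obtain ⟨k, hkq, hk⟩ := exists_zero_pos_on_union hT hq
  have hpos : ∀ x : X, 0 < k (stoneCechUnit x) := fun x =>
    hk _ (Or.inl (range_subset_hewitt ⟨x, rfl⟩))
  have hkt : ∀ p, Tendsto (fun x : X => k (stoneCechUnit x)) (comap stoneCechUnit (𝓝 p))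
      (𝓝 (k p)) := fun p => (k.continuous.tendsto p).comp tendsto_comap
  let f : C(X, ℝ) := ⟨fun x => (k (stoneCechUnit x))⁻¹,
    Continuous.inv₀ (k.continuous.comp continuous_stoneCechUnit) fun x => (hpos x).ne'⟩
  refine ⟨f, fun p hp => (isRealAt_iff f p).2 ⟨_, (hkt p).inv₀ (hk p (Or.inr hp)).ne'⟩, ?_⟩
  rw [not_isRealAt_iff_tendsto]
  refine tendsto_abs_atTop_atTop.comp (tendsto_inv_nhdsGT_zero.comp ?_)
  exact tendsto_nhdsWithin_iff.2 ⟨hkq ▸ hkt q, Eventually.of_forall hpos⟩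

lemma realOn_ne_boundedAdd {T : Set (StoneCech X)} (hT : T.Countable) (hTυ : T ⊆ (hewitt X)ᶜ)
    {q : StoneCech X} (hqT : q ∈ closure T) (hq : q ∉ hewitt X ∪ T) (I : Ideal C(X, ℝ)) :
    (realOn T : Set C(X, ℝ)) ≠ boundedAdd I := by
  intro h
  obtain ⟨f, hfT, hfq⟩ := exists_mem_realOn_not_isRealAt hT hq
  obtain ⟨b, hb, g, hg, rfl⟩ : f ∈ boundedAdd I := h ▸ hfT
  have hgq : ¬ IsRealAt g q := by
    intro hgq
    obtain ⟨r, hr⟩ := (isRealAt_iff g q).1 hgq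
    obtain ⟨s, hs⟩ := (isRealAt_iff b q).1 (isRealAt_of_bounded hb q)
    exact hfq ((isRealAt_iff _ q).2 ⟨s + r, hs.add hr⟩)
  obtain ⟨p, hpT, j, hj, hjp⟩ :=
    exists_mem_not_isRealAt (fun c d hd => I.mul_mem_left c hd) hTυ hqT hg hgq
  have hjT : j ∈ (realOn T : Set C(X, ℝ)) :=
    h ▸ ⟨0, ⟨0, fun x => by simp⟩, j, hj, (zero_add j).symm⟩
  exact hjp (hjT p hpT)

lemma union_ne_upsilon_supportIn {T : Set (StoneCech X)} (hTυ : T ⊆ (hewitt X)ᶜ)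
    {q : StoneCech X} (hqT : q ∈ closure T) (hq : q ∉ hewitt X ∪ T)
    (P : Order.Ideal (Closeds X)) : hewitt X ∪ T ≠ upsilon (supportIn P) := by
  intro h
  rw [h] at hq
  simp only [upsilon, mem_ofPred_eq, not_forall] at hq
  obtain ⟨f, hf, hfq⟩ := hq
  obtain ⟨p, hpT, j, hj, hjp⟩ :=
    exists_mem_not_isRealAt (fun c d hd => mul_mem_supportIn P c hd) hTυ hqT hf hfq
  have hp : p ∈ upsilon (supportIn P) := h ▸ Or.inr hpT
  exact hjp (hp j hj)

end

end ClosedSupport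

theorem theorem2p3 (X : Type u) [TopologicalSpace X] [T35Space X] :
    ((∀ Y : Set (StoneCech X), Set.range (stoneCechUnit : X → StoneCech X) ⊆ Y →
        ClosedSupport.IsRealcompact Y →
        ∃ P : Order.Ideal (TopologicalSpace.Closeds X),
          Y = ClosedSupport.upsilon (ClosedSupport.supportIn P)) ↔
      ClosedSupport.IsPseudocompact X) ∧
    (¬ ClosedSupport.IsPseudocompact X →
      ∃ T : Set (StoneCech X), T.Countable ∧ T.Infinite ∧ T ⊆ (ClosedSupport.hewitt X)ᶜ ∧
        ClosedSupport.IsIntermediate (ClosedSupport.realOn T) ∧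
        ClosedSupport.IsCType (ClosedSupport.realOn T) ∧
        ∀ I : Ideal C(X, ℝ),
          (ClosedSupport.realOn T : Set C(X, ℝ)) ≠ ClosedSupport.boundedAdd I) := by
  open ClosedSupport in
  refine ⟨⟨fun h => ?_, fun hX Y hY hYr => ⟨⊥, ?_⟩⟩, fun hX => ?_⟩
  · by_contra hX
    obtain ⟨T, hT, -, hTυ, q, hqT, hq⟩ := exists_countable_poles hX
    have hY : range (stoneCechUnit : X → StoneCech X) ⊆ hewitt X ∪ T :=
      range_subset_hewitt.trans subset_union_left
    obtain ⟨P, hP⟩ := h _ hY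
      (isRealcompact_of_exists_zero hY fun q hq => exists_zero_pos_on_union hT hq)
    exact union_ne_upsilon_supportIn hTυ hqT hq P hP
  · rw [eq_univ_of_isRealcompact hX hY hYr]
    exact (eq_univ_of_forall fun p f _ => isRealAt_of_bounded (hX f) p).symm
  · obtain ⟨T, hT, hTi, hTυ, q, hqT, hq⟩ := exists_countable_poles hX
    exact ⟨T, hT, hTi, hTυ, isIntermediate_realOn T, isCType_realOn T,
      realOn_ne_boundedAdd hT hTυ hqT hq⟩
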